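/- **Setting.** Let $K\ge 2$ be the number of classes. A task has $d_v$ invariant and $d_s$ spurious features. In class $k$ the $i$-th feature has a mean vector $\mu_i(k)\in\mathbb R^d$. An (out-of-distribution) example is generated as follows: the label $y$ is uniform on $\{1,\dots,K\}$; given $y$, an invariant feature is $x_i\sim\mathcal N(\mu_i(y),\sigma^2 I_d)$ and a spurious feature is $x_j\sim\mathcal N(\mu_j(q_j(y)),\sigma^2 I_d)$, where $q_j(k)=k$ with probability $1-p$ and $q_j(k)$ is uniform on $\{1,\dots,K\}$ with probability $p$; all choices are independent. A model is a pair $f=(\Phi,w)$ of feature weights $\Phi\in\mathbb R^{d_v+d_s}$ and a classifier $w=(w(1),\dots,w(K))\in\mathbb R^{d\times K}$; its output on $x$ is $w^\top\big(\sum_i\Phi_i x_i\big)\in\mathbb R^K$, and its accuracy $\xi_G(f)$ on the task $G$ is the probability that the strictly largest coordinate of the output is that of the label. A model has learned a set $\mathcal V$ of invariant and a set $\mathcal S$ of spurious features if $\Phi$ is the $0$-$1$ indicator of $\mathcal V\cup\mathcal S$ and $w(k)=\sum_{i\in\mathcal V\cup\mathcal S}\mu_i(k)$ for all $k$. The original model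 $\bar f$ has learned $\bar n_v$ invariant and $\bar n_s$ spurious features, the model $f^*$ has learned $n_v^*$ and $n_s^*$ of them, with $n_{vo}^*$ invariant and $n_{so}^*$ spurious features learned by both; $\tilde f=(\tilde\Phi,\tilde w)$ is the maliciously fine-tuned model. The assumptions are: 1. (Near-optimal extrapolation) $\Phi^*=\frac{\tilde\Phi-\lambda\bar\Phi}{1-\lambda}$, $w^*=\frac{\tilde w-\lambda\bar w}{1-\lambda}$, and $\big|\sup_f\xi_G(f)-\xi_G(f^*)\big|\le\epsilon$, the supremum being over all models. 2. (Small noise) $F\big(\tfrac1{\sigma(n_v'+n_s')}\big)^K\ge 1-\epsilon_n$, where $F$ is the standard Gaussian distribution function and $n_v'$, $n_s'$ are upper bounds for the numbers of invariant and of spurious features with nonzero weight in $\bar f$, $\tilde f$ and $f^*$. 3. (Orthogonal features) All vectors $\mu_i(k)$ (over all features $i$ and classes $k$) are unit vectors and they are pairwise orthogonal. **Theorem.** For all $K\ge2$, $p\in(0,1]$, $\lambda\in[0,1)$, $\epsilon>0$ and $\epsilon_n>0$ there are feature counts $\bar n_v,\bar n_s,n_v^*,n_s^*,n_{vo}^*,n_{so}^*$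 with $$\bar n_v>n_v^*\qquad\text{and}\qquad 0<\bar n_s<n_s^*,$$ and some $\sigma_0>0$, such that for every $\sigma\in(0,\sigma_0]$ the three assumptions can be satisfied with these parameters, and whenever they are satisfied with these parameters (for any dimensions, mean vectors and sets of learned features), the maliciously fine-tuned model is strictly less accurate on the general task $G$ than the original model: $$\xi_G(\tilde f)<\xi_G(\bar f).$$ -/

import Mathlib

open MeasureTheory ProbabilityTheory
open scoped ENNReal

noncomputable section

namespace FineTuning

/-- The indices of all features: `dv` invariant ones followed by `ds` spurious ones. -/
abbrev Feature (dv ds : ℕ) : Type := Fin dv ⊕ Fin ds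

/-- A task: `mean i k` is the mean vector of the `i`-th feature in class `k`, `sigma` is the standard
deviation of the feature noise, `p` is the probability with which, out of distribution, a spurious
feature has its class resampled. -/
structure Task (K d dv ds : ℕ) where
  mean : Feature dv ds → Fin K → EuclideanSpace ℝ (Fin d)
  sigma : ℝ
  p : ℝ

/-- The randomness behind one out-of-distribution example: the label `y`; for each spurious feature
`j` the `0`-`1` matrix `Q j`, recorded as the map `k ↦ k'` saying that its `k`-th column is the unit
vector `e_{k'}`; and for each feature a noise vector. -/
abbrev Outcome (K d dv ds : ℕ) : Type :=
  Fin K × (Fin ds → Fin K → Fin K) × (Feature dv ds → EuclideanSpace ℝ (Fin d))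

/-- The uniform distribution on the `K` classes. -/
def uniformLaw (K : ℕ) : Measure (Fin K) := (K : ℝ≥0∞)⁻¹ • Measure.count

/-- The law of the `k`-th column of the matrix of a spurious feature: `e_k` with probability
`1 - p`, and uniform on the unit vectors with probability `p`. -/
def columnLaw (K : ℕ) (p : ℝ) (k : Fin K) : Measure (Fin K) :=
  ENNReal.ofReal (1 - p) • Measure.dirac k + ENNReal.ofReal p • uniformLaw K

/-- The law of an outcome: the label is uniform, the columns have law `columnLaw`, the noise vectors
are standard Gaussian, and all of them are independent. -/
def outcomeLaw (K d dv ds : ℕ) (p : ℝ) : Measure (Outcome K d dv ds) :=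
  (uniformLaw K).prod
    ((Measure.pi fun _ : Fin ds => Measure.pi fun k : Fin K => columnLaw K p k).prod
      (Measure.pi fun _ : Feature dv ds => stdGaussian (EuclideanSpace ℝ (Fin d))))

variable {K d dv ds : ℕ}

/-- The feature vector `x_i`: given the label and the matrices it has law
`N(μ_i Q_i y, σ² I_d)`, where `Q_i` is the identity if `i` is invariant. -/
def Task.featureVector (T : Task K d dv ds) (o : Outcome K d dv ds) :
    Feature dv ds → EuclideanSpace ℝ (Fin d)
  | .inl i => T.mean (.inl i) o.1 + T.sigma • o.2.2 (.inl i)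
  | .inr j => T.mean (.inr j) (o.2.1 j o.1) + T.sigma • o.2.2 (.inr j)

/-- A model `f = (Φ, w)`: weights `Φ` of the features (`0` or `1` for a feature selector, real for
an interpolation of two selectors) and a classifier `w` with columns `w k`. -/
@[ext]
structure Model (K d dv ds : ℕ) where
  Φ : Feature dv ds → ℝ
  w : Fin K → EuclideanSpace ℝ (Fin d)

/-- The `k`-th coordinate of the output `wᵀ (x Φ)`. -/
def Model.output (f : Model K d dv ds) (x : Feature dv ds → EuclideanSpace ℝ (Fin d))
    (k : Fin K) : ℝ :=
  inner ℝ (f.w k) (∑ i, f.Φ i • x i)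

/-- The accuracy `ξ(f)` on the task: the probability that, out of distribution, the largest
coordinate of the output is that of the label. -/
def Task.accuracy (T : Task K d dv ds) (f : Model K d dv ds) : ℝ :=
  (outcomeLaw K d dv ds T.p).real
    {o | ∀ k, k ≠ o.1 → f.output (T.featureVector o) k < f.output (T.featureVector o) o.1}

/-- The optimal accuracy on the task. -/
def Task.optimalAccuracy (T : Task K d dv ds) : ℝ := ⨆ f : Model K d dv ds, T.accuracy f

/-- `f` has learned the invariant features in `V` and the spurious features in `S`: it selects these
features, and the `k`-th column of its classifier is the sum of their means in class `k`. -/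
structure Model.Learns (f : Model K d dv ds) (T : Task K d dv ds) (V : Finset (Fin dv))
    (S : Finset (Fin ds)) : Prop where
  selector : ∀ i, f.Φ i = if i ∈ V.disjSum S then 1 else 0
  classifier : ∀ k, f.w k = ∑ i ∈ V.disjSum S, T.mean i k

/-- The number of invariant features that `f` uses. -/
def Model.numInvariant (f : Model K d dv ds) : ℕ := Nat.card {i : Fin dv // f.Φ (.inl i) ≠ 0}

/-- The number of spurious features that `f` uses. -/
def Model.numSpurious (f : Model K d dv ds) : ℕ := Nat.card {j : Fin ds // f.Φ (.inr j) ≠ 0}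

/-- The extrapolation `(f' - lam f) / (1 - lam)`, in the selectors and in the classifiers. -/
def Model.extrapolate (lam : ℝ) (f f' : Model K d dv ds) : Model K d dv ds where
  Φ i := (f'.Φ i - lam * f.Φ i) / (1 - lam)
  w k := (1 - lam)⁻¹ • (f'.w k - lam • f.w k)

/-- Assumption 1: `fStar` is the extrapolation from the original model `fBar` and the
fine-tuned model `fTilde`, and its accuracy is within `ε` of the optimal one. -/
structure NearOptimalExtrapolation (T : Task K d dv ds) (lam ε : ℝ)
    (fBar fTilde fStar : Model K d dv ds) : Prop where
  extrapolation : fStar = Model.extrapolate lam fBar fTilde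
  near_optimal : |T.optimalAccuracy - T.accuracy fStar| ≤ ε

/-- Assumption 2 (small noise): `F(1 / (σ (n_v' + n_s')))^K ≥ 1 - εn`, where `F` is the standard
Gaussian distribution function. -/
def Task.SmallNoise (T : Task K d dv ds) (nvMax nsMax : ℕ) (εn : ℝ) : Prop :=
  1 - εn ≤ cdf (gaussianReal 0 1) (1 / (T.sigma * (nvMax + nsMax))) ^ K

/-- Assumption 3 (orthogonal features): the mean vectors of all features in all classes are unit
vectors and pairwise orthogonal. -/
structure Task.OrthogonalFeatures (T : Task K d dv ds) : Prop where
  norm_eq_one : ∀ i k, ‖T.mean i k‖ = 1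
  orthogonal : ∀ i k i' k', (i, k) ≠ (i', k') → inner ℝ (T.mean i k) (T.mean i' k') = 0

/-- The numbers of features learned by the original model (`Bar`), by the near-optimal model
(`Star`), and by both (`o`). -/
structure FeatureCounts where
  nvBar : ℕ
  nsBar : ℕ
  nvStar : ℕ
  nsStar : ℕ
  nvo : ℕ
  nso : ℕ

/-- A task with the original model, the fine-tuned model and the model `f*`, the
features learned by the first and the last, and the maximal numbers of features that a model can
learn. -/
structure Scenario (K d dv ds : ℕ) where
  task : Task K d dv ds
  fBar : Model K d dv ds
  fTilde : Model K d dv ds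
  fStar : Model K d dv ds
  VBar : Finset (Fin dv)
  SBar : Finset (Fin ds)
  VStar : Finset (Fin dv)
  SStar : Finset (Fin ds)
  nvMax : ℕ
  nsMax : ℕ

/-- The scenario has resampling probability `p`, noise level `σ` and the feature counts `c`. -/
structure Scenario.HasParameters (X : Scenario K d dv ds) (p σ : ℝ) (c : FeatureCounts) :
    Prop where
  p_eq : X.task.p = p
  sigma_eq : X.task.sigma = σ
  learns_bar : X.fBar.Learns X.task X.VBar X.SBar
  learns_star : X.fStar.Learns X.task X.VStar X.SStar
  card_VBar : X.VBar.card = c.nvBar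
  card_SBar : X.SBar.card = c.nsBar
  card_VStar : X.VStar.card = c.nvStar
  card_SStar : X.SStar.card = c.nsStar
  card_Vo : (X.VStar ∩ X.VBar).card = c.nvo
  card_So : (X.SStar ∩ X.SBar).card = c.nso
  le_nvMax : ∀ f ∈ [X.fBar, X.fTilde, X.fStar], f.numInvariant ≤ X.nvMax
  le_nsMax : ∀ f ∈ [X.fBar, X.fTilde, X.fStar], f.numSpurious ≤ X.nsMax

/-- The three assumptions hold. -/
structure Scenario.Assumptions (X : Scenario K d dv ds) (lam ε εn : ℝ) : Prop where
  near_optimal : NearOptimalExtrapolation X.task lam ε X.fBar X.fTilde X.fStar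
  small_noise : X.task.SmallNoise X.nvMax X.nsMax εn
  orthogonal : X.task.OrthogonalFeatures

end FineTuning

end

namespace FineTuning

variable {K d dv ds : ℕ}

/-! Orthonormal means turn each output into a weighted vote. Every feature votes, with its squared
weight, for the class it shows, and the noise perturbs the totals by `O(σ)`. Up to an error
probability of order `σ ^ 2`, accuracy is therefore a question about votes (`Task.le_accuracy`,
`Task.accuracy_le`).

Take `m + 1` invariant features and one spurious feature for the original model, and `m` and `R * m`
new ones for `f*`. The original model has an invariant majority, so it errs only through noise. In
`f*` the spurious features dominate, but they are independent and on average do not favour a wrong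
class; by Chebyshev (`pi_chebyshev`) they outvote the invariant ones with probability `O(R / m)`, so
`f*` is near-optimal for large `m`. The fine-tuned model interpolates the two and gives the spurious
features of `f*` weight at least `1 - lam`. For `R` of order `(1 - lam)⁻²` they win whenever they
all show one wrong class, an event of probability at least `(p / K) ^ (R * m)`. This loss does not
depend on `σ`, whereas that of the original model vanishes with `σ`. -/

theorem pi_chebyshev {ι : Type*} [Fintype ι] {Ω : ι → Type*} [∀ i, MeasurableSpace (Ω i)]
    {μ : (i : ι) → Measure (Ω i)} [∀ i, IsProbabilityMeasure (μ i)] {X : ∀ i, Ω i → ℝ}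
    (hX : ∀ i, MemLp (X i) 2 (μ i)) {c v : ℝ} (hc : 0 < c) (hv : ∑ i, Var[X i; μ i] ≤ v) :
    (Measure.pi μ).real {ω | c ≤ |∑ i, X i (ω i) - ∑ i, (μ i)[X i]|} ≤ v / c ^ 2 := by
  have hL : ∀ i, MemLp (fun ω : ∀ i, Ω i => X i (ω i)) 2 (Measure.pi μ) := fun i =>
    (hX i).comp_measurePreserving (measurePreserving_eval _ i)
  have hmean : (Measure.pi μ)[∑ i, fun ω => X i (ω i)] = ∑ i, (μ i)[X i] := by
    simp only [Finset.sum_apply]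
    rw [integral_finsetSum _ fun i _ => (hL i).integrable (by norm_num)]
    refine Finset.sum_congr rfl fun i _ => ?_
    have h := (measurePreserving_eval μ i).map_eq
    conv_rhs => rw [← h]
    refine (integral_map (φ := Function.eval i) (measurable_pi_apply i).aemeasurable ?_).symm
    rw [h]
    exact (hX i).aestronglyMeasurable
  have hL2 : MemLp (∑ i, fun ω : ∀ i, Ω i => X i (ω i)) 2 (Measure.pi μ) :=
    memLp_finsetSum' _ fun i _ => hL i
  have h := meas_ge_le_variance_div_sq hL2 hc
  rw [variance_sum_pi hX, hmean] at h
  simp only [Finset.sum_apply] at h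
  have hv0 : 0 ≤ ∑ i, Var[X i; μ i] := Finset.sum_nonneg fun i _ => variance_nonneg _ _
  refine (ENNReal.toReal_mono ENNReal.ofReal_ne_top h).trans ?_
  rw [ENNReal.toReal_ofReal (by positivity)]
  gcongr

/-! ### Outputs as votes plus noise -/

/-- The deterministic part of the `k`-th output of a model whose classifier is the weighted sum of
the class means, for an example with label `y` and spurious feature classes `Q j y`. -/
noncomputable def Model.score (f : Model K d dv ds) (y : Fin K) (Q : Fin ds → Fin K → Fin K)
    (k : Fin K) : ℝ :=
  (∑ i, f.Φ (.inl i) ^ 2) * (if y = k then 1 else 0) +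
    ∑ j, f.Φ (.inr j) ^ 2 * (if Q j y = k then 1 else 0)

/-- The contribution of the standardized feature noise to the `k`-th output. -/
noncomputable def Model.noise (f : Model K d dv ds) (k : Fin K)
    (z : Feature dv ds → EuclideanSpace ℝ (Fin d)) : ℝ :=
  inner ℝ (f.w k) (∑ i, f.Φ i • z i)

/-- The total squared feature weight. -/
noncomputable def Model.energy (f : Model K d dv ds) : ℝ := ∑ i, f.Φ i ^ 2

/-- The classifier of `f` is the combination of the class means with the feature weights. -/
def Model.IsMatched (f : Model K d dv ds) (T : Task K d dv ds) : Prop :=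
  ∀ k, f.w k = ∑ i, f.Φ i • T.mean i k

theorem Task.OrthogonalFeatures.inner_eq {T : Task K d dv ds} (hT : T.OrthogonalFeatures)
    (i i' : Feature dv ds) (k k' : Fin K) :
    inner ℝ (T.mean i k) (T.mean i' k') = if i = i' then (if k' = k then 1 else 0) else 0 := by
  by_cases h : (i, k) = (i', k')
  · obtain ⟨rfl, rfl⟩ := Prod.mk.inj h
    simp [hT.norm_eq_one]
  · rw [hT.orthogonal _ _ _ _ h]
    by_cases hi : i = i'
    · subst hi
      have : k' ≠ k := fun hk => h (by rw [hk])
      simp [this]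
    · simp [hi]

theorem Model.IsMatched.inner_w_mean {f : Model K d dv ds} {T : Task K d dv ds}
    (hf : f.IsMatched T) (hT : T.OrthogonalFeatures) (i : Feature dv ds) (k k' : Fin K) :
    inner ℝ (f.w k) (T.mean i k') = f.Φ i * if k' = k then 1 else 0 := by
  rw [hf k, sum_inner]
  simp only [real_inner_smul_left, hT.inner_eq]
  simp

theorem Model.IsMatched.norm_w_sq {f : Model K d dv ds} {T : Task K d dv ds}
    (hf : f.IsMatched T) (hT : T.OrthogonalFeatures) (k : Fin K) :
    ‖f.w k‖ ^ 2 = f.energy := by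
  rw [← real_inner_self_eq_norm_sq]
  nth_rw 2 [hf k]
  rw [inner_sum]
  simp only [real_inner_smul_right, hf.inner_w_mean hT]
  simp [Model.energy, sq]

/-- Orthogonality removes all cross terms. A weight enters once through the selector and once
through the classifier, so votes count with squared weights. -/
theorem Model.IsMatched.output_eq {f : Model K d dv ds} {T : Task K d dv ds}
    (hf : f.IsMatched T) (hT : T.OrthogonalFeatures) (o : Outcome K d dv ds) (k : Fin K) :
    f.output (T.featureVector o) k = f.score o.1 o.2.1 k + T.sigma * f.noise k o.2.2 := by
  simp only [Model.output, Model.score, Model.noise, Fintype.sum_sum_type, Task.featureVector,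
    smul_add, Finset.sum_add_distrib, inner_add_right, inner_sum, real_inner_smul_right,
    hf.inner_w_mean hT, Finset.sum_mul, Finset.mul_sum, mul_add]
  have h2 : ∀ a b : ℝ, a * (a * b) = a ^ 2 * b := fun a b => by ring
  simp only [h2, mul_left_comm _ T.sigma]
  ring

theorem Model.noise_tail {f : Model K d dv ds} {T : Task K d dv ds} (hf : f.IsMatched T)
    (hT : T.OrthogonalFeatures) (k : Fin K) {c : ℝ} (hc : 0 < c) :
    (Measure.pi fun _ : Feature dv ds => stdGaussian (EuclideanSpace ℝ (Fin d))).real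
      {z | c ≤ |f.noise k z|} ≤ f.energy ^ 2 / c ^ 2 := by
  let L : Feature dv ds → StrongDual ℝ (EuclideanSpace ℝ (Fin d)) := fun i =>
    f.Φ i • innerSL ℝ (f.w k)
  have h := pi_chebyshev (μ := fun _ : Feature dv ds => stdGaussian (EuclideanSpace ℝ (Fin d)))
    (X := fun i => (L i : EuclideanSpace ℝ (Fin d) → ℝ)) (c := c) (v := f.energy ^ 2)
    (fun i => IsGaussian.memLp_dual _ _ _ (by norm_num)) hc (by
      -- One factor `energy` comes from the selector weights, the other from `‖f.w k‖ ^ 2`.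
      refine le_of_eq ?_
      simp only [variance_dual_stdGaussian]
      simp only [L, norm_smul, innerSL_apply_norm, mul_pow, hf.norm_w_sq hT, Real.norm_eq_abs, sq_abs]
      rw [← Finset.sum_mul, Model.energy, sq])
  simp only [integral_strongDual_stdGaussian] at h
  convert h using 5
  simp only [Model.noise, L, inner_sum, real_inner_smul_right]
  simp

/-- The noise vectors for which no output is perturbed by `1 / 2` or more. -/
def Model.quietSet (f : Model K d dv ds) (σ : ℝ) :
    Set (Feature dv ds → EuclideanSpace ℝ (Fin d)) :=
  {z | ∀ k, σ * |f.noise k z| < 1 / 2}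

theorem Model.measurableSet_quietSet (f : Model K d dv ds) (σ : ℝ) :
    MeasurableSet (f.quietSet σ) := by
  have : f.quietSet σ = ⋂ k, {z | σ * |f.noise k z| < 1 / 2} := by
    ext; simp [Model.quietSet]
  rw [this]
  refine MeasurableSet.iInter fun k => measurableSet_lt ?_ measurable_const
  refine Continuous.measurable ?_
  unfold Model.noise
  fun_prop

theorem Model.quietSet_compl_le {f : Model K d dv ds} {T : Task K d dv ds} (hf : f.IsMatched T)
    (hT : T.OrthogonalFeatures) {σ : ℝ} (hσ : 0 < σ) :
    (Measure.pi fun _ : Feature dv ds => stdGaussian (EuclideanSpace ℝ (Fin d))).real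
      (f.quietSet σ)ᶜ ≤ 4 * K * σ ^ 2 * f.energy ^ 2 := by
  have hsub : (f.quietSet σ)ᶜ ⊆ ⋃ k, {z | 1 / (2 * σ) ≤ |f.noise k z|} := by
    intro z hz
    simp only [Model.quietSet, Set.mem_compl_iff, Set.mem_ofPred_eq, not_forall, not_lt] at hz
    obtain ⟨k, hk⟩ := hz
    refine Set.mem_iUnion.2 ⟨k, ?_⟩
    rw [Set.mem_ofPred_eq, div_le_iff₀ (by positivity)]
    linarith
  refine (measureReal_mono hsub).trans ((measureReal_iUnion_fintype_le _).trans ?_)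
  refine (Finset.sum_le_sum fun k _ => f.noise_tail hf hT k (by positivity)).trans ?_
  simp only [Finset.sum_const, Finset.card_univ, Fintype.card_fin, nsmul_eq_mul]
  refine le_of_eq ?_
  field_simp
  ring

/-! ### The law of labels and class resampling -/

theorem uniformLaw_singleton (k : Fin K) : uniformLaw K {k} = (K : ℝ≥0∞)⁻¹ := by
  simp [uniformLaw]

theorem isProbabilityMeasure_uniformLaw (hK : K ≠ 0) : IsProbabilityMeasure (uniformLaw K) := by
  constructor
  simp [uniformLaw, Measure.count_univ]
  exact ENNReal.inv_mul_cancel (by simpa using hK) (by simp)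

theorem isProbabilityMeasure_columnLaw (hK : K ≠ 0) {p : ℝ} (hp0 : 0 ≤ p) (hp1 : p ≤ 1)
    (k : Fin K) : IsProbabilityMeasure (columnLaw K p k) := by
  have := isProbabilityMeasure_uniformLaw hK
  constructor
  simp only [columnLaw, Measure.add_apply, Measure.smul_apply, measure_univ, smul_eq_mul, mul_one]
  rw [← ENNReal.ofReal_add (by linarith) hp0]
  simp

theorem columnLaw_real_singleton {p : ℝ} (hp0 : 0 ≤ p) (hp1 : p ≤ 1) (k k' : Fin K) :
    (columnLaw K p k).real {k'} = (1 - p) * (if k' = k then 1 else 0) + p / K := by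
  have hK : (K : ℝ≥0∞) ≠ 0 := by
    have := k.pos
    simp; omega
  rw [measureReal_def, columnLaw, Measure.add_apply, Measure.smul_apply, Measure.smul_apply,
    uniformLaw_singleton, Measure.dirac_apply, smul_eq_mul, smul_eq_mul,
    ENNReal.toReal_add (ENNReal.mul_ne_top (by simp) (by
      by_cases h : k = k' <;> simp [h])) (ENNReal.mul_ne_top (by simp) (by simpa using hK)),
    ENNReal.toReal_mul, ENNReal.toReal_mul, ENNReal.toReal_ofReal (by linarith),
    ENNReal.toReal_ofReal hp0]
  by_cases h : k' = k
  · simp [h, div_eq_mul_inv]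
  · simp [h, Ne.symm h, div_eq_mul_inv]

/-- The law of the matrices of the spurious features. -/
noncomputable abbrev matrixLaw (K ds : ℕ) (p : ℝ) : Measure (Fin ds → Fin K → Fin K) :=
  Measure.pi fun _ : Fin ds => Measure.pi fun k : Fin K => columnLaw K p k

/-- The law of the feature noise. -/
noncomputable abbrev noiseLaw (d dv ds : ℕ) :
    Measure (Feature dv ds → EuclideanSpace ℝ (Fin d)) :=
  Measure.pi fun _ : Feature dv ds => stdGaussian (EuclideanSpace ℝ (Fin d))

theorem isProbabilityMeasure_matrixLaw (hK : K ≠ 0) {p : ℝ} (hp0 : 0 ≤ p) (hp1 : p ≤ 1) :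
    IsProbabilityMeasure (matrixLaw K ds p) := by
  have := isProbabilityMeasure_columnLaw hK hp0 hp1
  infer_instance

theorem isProbabilityMeasure_outcomeLaw (hK : K ≠ 0) {p : ℝ} (hp0 : 0 ≤ p) (hp1 : p ≤ 1) :
    IsProbabilityMeasure (outcomeLaw K d dv ds p) := by
  have := isProbabilityMeasure_uniformLaw hK
  have := isProbabilityMeasure_columnLaw hK hp0 hp1
  unfold outcomeLaw
  infer_instance

theorem outcomeLaw_real_prod (hK : K ≠ 0) {p : ℝ} (hp0 : 0 ≤ p) (hp1 : p ≤ 1) (A : Set (Fin K))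
    (B : Set (Fin ds → Fin K → Fin K)) (C : Set (Feature dv ds → EuclideanSpace ℝ (Fin d))) :
    (outcomeLaw K d dv ds p).real (A ×ˢ B ×ˢ C) =
      (uniformLaw K).real A * ((matrixLaw K ds p).real B * (noiseLaw d dv ds).real C) := by
  have := isProbabilityMeasure_uniformLaw hK
  have := isProbabilityMeasure_columnLaw hK hp0 hp1
  unfold outcomeLaw
  rw [measureReal_prod_prod, measureReal_prod_prod]

theorem Task.accuracy_le_one (T : Task K d dv ds) (hK : K ≠ 0) (hp0 : 0 ≤ T.p) (hp1 : T.p ≤ 1)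
    (f : Model K d dv ds) : T.accuracy f ≤ 1 := by
  have := isProbabilityMeasure_outcomeLaw (d := d) (dv := dv) (ds := ds) hK hp0 hp1
  exact measureReal_le_one

/-! ### Accuracy bounds from noiseless margins -/

/-- If the label beats every other class by a margin of `1` up to probability `δ` in the absence
of noise, then the accuracy is at least `1 - δ` up to a term of order `σ ^ 2`. -/
theorem Task.le_accuracy {T : Task K d dv ds} (hT : T.OrthogonalFeatures) (hK : K ≠ 0)
    (hp0 : 0 ≤ T.p) (hp1 : T.p ≤ 1) (hσ : 0 < T.sigma) {f : Model K d dv ds}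
    (hf : f.IsMatched T) {δ : ℝ}
    (hδ : ∀ y, (matrixLaw K ds T.p).real
      {Q | ∃ k, k ≠ y ∧ f.score y Q y < f.score y Q k + 1} ≤ δ) :
    1 - δ - 4 * K * T.sigma ^ 2 * f.energy ^ 2 ≤ T.accuracy f := by
  have := isProbabilityMeasure_uniformLaw hK
  have := isProbabilityMeasure_matrixLaw (ds := ds) hK hp0 hp1
  have := isProbabilityMeasure_outcomeLaw (d := d) (dv := dv) (ds := ds) hK hp0 hp1
  set M : Fin K → Set (Fin ds → Fin K → Fin K) := fun y =>
    {Q | ∃ k, k ≠ y ∧ f.score y Q y < f.score y Q k + 1} with hM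
  set S := {o | ∀ k, k ≠ o.1 → f.output (T.featureVector o) k < f.output (T.featureVector o) o.1}
    with hS
  -- Subadditivity over a cover of the whole space avoids measurability of `S`. On the quiet set two
  -- outputs shift against each other by less than `1`, so a margin of `1` survives.
  have hcover : (Set.univ : Set (Outcome K d dv ds)) ⊆
      S ∪ ((Set.univ ×ˢ Set.univ ×ˢ (f.quietSet T.sigma)ᶜ) ∪
        ⋃ y, {y} ×ˢ M y ×ˢ Set.univ) := by
    rintro ⟨y, Q, z⟩ -
    by_contra hcon
    simp only [Set.mem_union, Set.mem_prod, Set.mem_univ, true_and, Set.mem_iUnion,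
      Set.mem_singleton_iff, and_true, not_or, not_exists, not_and, Set.mem_compl_iff,
      not_not] at hcon
    obtain ⟨h1, h2, h3⟩ := hcon
    apply h1
    intro k hk
    have h4 := h3 y rfl
    simp only [hM, Set.mem_ofPred_eq, not_exists, not_and, not_lt] at h4
    have h5 := h4 k hk
    rw [hf.output_eq hT, hf.output_eq hT]
    have a1 := h2 k
    have a2 := h2 y
    have b1 := mul_le_mul_of_nonneg_left (le_abs_self (f.noise k z)) hσ.le
    have b2 := mul_le_mul_of_nonneg_left (neg_abs_le (f.noise y z)) hσ.le
    simp only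
    linarith
  have h := measureReal_mono (μ := outcomeLaw K d dv ds T.p) hcover
  rw [probReal_univ] at h
  have h1 := measureReal_union_le (μ := outcomeLaw K d dv ds T.p) S
    ((Set.univ ×ˢ Set.univ ×ˢ (f.quietSet T.sigma)ᶜ) ∪ ⋃ y, {y} ×ˢ M y ×ˢ Set.univ)
  have h2 := measureReal_union_le (μ := outcomeLaw K d dv ds T.p)
    (Set.univ ×ˢ Set.univ ×ˢ (f.quietSet T.sigma)ᶜ) (⋃ y, {y} ×ˢ M y ×ˢ Set.univ)
  have h3 : (outcomeLaw K d dv ds T.p).real (Set.univ ×ˢ Set.univ ×ˢ (f.quietSet T.sigma)ᶜ) ≤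
      4 * K * T.sigma ^ 2 * f.energy ^ 2 := by
    rw [outcomeLaw_real_prod hK hp0 hp1]
    simpa using Model.quietSet_compl_le hf hT hσ
  have h4 : (outcomeLaw K d dv ds T.p).real (⋃ y, {y} ×ˢ M y ×ˢ Set.univ) ≤ δ := by
    refine (measureReal_iUnion_fintype_le _).trans ?_
    have hy : ∀ y, (outcomeLaw K d dv ds T.p).real ({y} ×ˢ M y ×ˢ Set.univ) ≤ (K : ℝ)⁻¹ * δ := by
      intro y
      rw [outcomeLaw_real_prod hK hp0 hp1, measureReal_def, uniformLaw_singleton]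
      simp only [ENNReal.toReal_inv, ENNReal.toReal_natCast, probReal_univ, mul_one]
      exact mul_le_mul_of_nonneg_left (hδ y) (by positivity)
    refine (Finset.sum_le_sum fun y _ => hy y).trans (le_of_eq ?_)
    have : (K : ℝ) ≠ 0 := by exact_mod_cast hK
    simp
    field_simp
  change _ ≤ (outcomeLaw K d dv ds T.p).real S
  linarith

/-- If for one label some other class beats it by a margin of `1` with probability at least `δ` in
the absence of noise, then the accuracy is bounded away from `1` when the noise is small. -/
theorem Task.accuracy_le {T : Task K d dv ds} (hT : T.OrthogonalFeatures) (hK : K ≠ 0)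
    (hp0 : 0 ≤ T.p) (hp1 : T.p ≤ 1) (hσ : 0 < T.sigma) {f : Model K d dv ds}
    (hf : f.IsMatched T) (hsmall : 4 * K * T.sigma ^ 2 * f.energy ^ 2 ≤ 1 / 2) {δ : ℝ} {y k : Fin K}
    (hyk : k ≠ y) {A : Set (Fin ds → Fin K → Fin K)}
    (hA : ∀ Q ∈ A, f.score y Q y + 1 ≤ f.score y Q k) (hδ : δ ≤ (matrixLaw K ds T.p).real A) :
    T.accuracy f ≤ 1 - δ / (2 * K) := by
  have := isProbabilityMeasure_outcomeLaw (d := d) (dv := dv) (ds := ds) hK hp0 hp1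
  set S := {o | ∀ k, k ≠ o.1 → f.output (T.featureVector o) k < f.output (T.featureVector o) o.1}
    with hS
  set E : Set (Outcome K d dv ds) := {y} ×ˢ A ×ˢ f.quietSet T.sigma with hE
  have hEm : MeasurableSet E :=
    (measurableSet_singleton y).prod (A.toFinite.measurableSet.prod (f.measurableSet_quietSet _))
  have hdisj : Disjoint S E := by
    rw [Set.disjoint_left]
    rintro ⟨y', Q, z⟩ h1 ⟨hy, hQ, hz⟩
    obtain rfl : y' = y := hy
    have h2 := h1 k hyk
    rw [hf.output_eq hT, hf.output_eq hT] at h2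
    have h5 := hA Q hQ
    have a1 := hz k
    have a2 := hz y'
    have b1 := mul_le_mul_of_nonneg_left (le_abs_self (f.noise y' z)) hσ.le
    have b2 := mul_le_mul_of_nonneg_left (neg_abs_le (f.noise k z)) hσ.le
    simp only at h2 a1 a2
    linarith
  have h := measureReal_union (μ := outcomeLaw K d dv ds T.p) hdisj hEm
  have h1 : (outcomeLaw K d dv ds T.p).real (S ∪ E) ≤ 1 := measureReal_le_one
  -- The label is `y` with probability `1 / K`, and independently the noise is quiet with
  -- probability at least `1 / 2`.
  have h2 : δ / (2 * K) ≤ (outcomeLaw K d dv ds T.p).real E := by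
    rw [hE, outcomeLaw_real_prod hK hp0 hp1, measureReal_def, uniformLaw_singleton]
    simp only [ENNReal.toReal_inv, ENNReal.toReal_natCast]
    have h3 := Model.quietSet_compl_le hf hT hσ
    rw [probReal_compl_eq_one_sub (f.measurableSet_quietSet _)] at h3
    have h4 : 1 / 2 ≤ (noiseLaw d dv ds).real (f.quietSet T.sigma) := by linarith
    have h5 : δ * (1 / 2) ≤
        (matrixLaw K ds T.p).real A * (noiseLaw d dv ds).real (f.quietSet T.sigma) :=
      (mul_le_mul_of_nonneg_right hδ (by norm_num)).trans
        (mul_le_mul_of_nonneg_left h4 measureReal_nonneg)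
    have h6 := mul_le_mul_of_nonneg_left h5 (by positivity : 0 ≤ (K : ℝ)⁻¹)
    calc δ / (2 * K) = (K : ℝ)⁻¹ * (δ * (1 / 2)) := by rw [div_eq_mul_inv, mul_inv]; ring
      _ ≤ _ := h6
  change (outcomeLaw K d dv ds T.p).real S ≤ _
  linarith

/-! ### Collective behaviour of the spurious features -/

/-- The probability that the spurious features in `S` all show class `k'` in place of `k`. -/
theorem pow_le_matrixLaw_real (hK : K ≠ 0) {p : ℝ} (hp0 : 0 ≤ p) (hp1 : p ≤ 1)
    (S : Finset (Fin ds)) (k k' : Fin K) :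
    (p / K) ^ S.card ≤ (matrixLaw K ds p).real {Q | ∀ j ∈ S, Q j k = k'} := by
  have := isProbabilityMeasure_columnLaw hK hp0 hp1
  have hset : {Q : Fin ds → Fin K → Fin K | ∀ j ∈ S, Q j k = k'} =
      Set.univ.pi fun j =>
        if j ∈ S then (Function.eval k ⁻¹' {k'} : Set (Fin K → Fin K)) else Set.univ := by
    ext Q
    simp only [Set.mem_ofPred_eq, Set.mem_pi, Set.mem_univ, true_implies]
    refine forall_congr' fun j => ?_
    by_cases hj : j ∈ S <;> simp [hj]
  rw [hset, measureReal_def, Measure.pi_pi, ENNReal.toReal_prod]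
  have hj : ∀ j : Fin ds, ((Measure.pi fun k : Fin K => columnLaw K p k)
      (if j ∈ S then Function.eval k ⁻¹' {k'} else Set.univ)).toReal =
      if j ∈ S then (columnLaw K p k).real {k'} else 1 := by
    intro j
    by_cases hj : j ∈ S
    · simp only [hj, if_true]
      rw [(measurePreserving_eval (fun k => columnLaw K p k) k).measure_preimage
        (measurableSet_singleton k').nullMeasurableSet, measureReal_def]
    · simp [hj]
  simp only [hj]
  rw [Finset.prod_ite_mem, Finset.univ_inter, Finset.prod_const]
  refine pow_le_pow_left₀ (by positivity) ?_ _
  rw [columnLaw_real_singleton hp0 hp1]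
  have : 0 ≤ (1 - p) * (if k' = k then 1 else 0) := by
    split_ifs <;> linarith
  linarith

/-- It is unlikely that among the features in `S` those that show class `k'` in place of `k`
outnumber those that show `k` substantially. -/
theorem matrixLaw_real_excess_le (hK : K ≠ 0) {p : ℝ} (hp0 : 0 ≤ p) (hp1 : p ≤ 1)
    (S : Finset (Fin ds)) {k k' : Fin K} {c : ℝ} (hc : 0 < c) :
    (matrixLaw K ds p).real {Q | c ≤ ∑ j ∈ S, ((if Q j k = k' then 1 else 0) -
      (if Q j k = k then 1 else 0) : ℝ)} ≤ S.card / c ^ 2 := by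
  have := isProbabilityMeasure_columnLaw hK hp0 hp1
  let g : Fin K → ℝ := fun a => (if a = k' then 1 else 0) - (if a = k then 1 else 0)
  have hg : ∀ a, g a ∈ Set.Icc (-1 : ℝ) 1 := by
    intro a
    simp only [g]
    split_ifs <;> norm_num
  let X : Fin ds → (Fin K → Fin K) → ℝ := fun j q => if j ∈ S then g (q k) else 0
  have hXb : ∀ j q, X j q ∈ Set.Icc (-1 : ℝ) 1 := by
    intro j q
    by_cases hj : j ∈ S
    · simpa only [X, hj, if_true] using hg (q k)
    · simp [X, hj]
  have hXm : ∀ j, Measurable (X j) := fun j => measurable_of_finite _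
  have hX : ∀ j, MemLp (X j) 2 (Measure.pi fun k : Fin K => columnLaw K p k) := fun j =>
    memLp_of_bounded (Filter.Eventually.of_forall (hXb j)) (hXm j).aestronglyMeasurable 2
  have hvar : ∑ j, Var[X j; Measure.pi fun k : Fin K => columnLaw K p k] ≤ S.card := by
    have : ∀ j, Var[X j; Measure.pi fun k : Fin K => columnLaw K p k] ≤ if j ∈ S then 1 else 0 := by
      intro j
      by_cases hj : j ∈ S
      · refine (variance_le_sq_of_bounded (Filter.Eventually.of_forall (hXb j))
          (hXm j).aemeasurable).trans ?_
        simp only [hj, if_true]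
        norm_num
      · have : X j = 0 := by ext q; simp [X, hj]
        rw [this, variance_zero]
        simp [hj]
    refine (Finset.sum_le_sum fun j _ => this j).trans ?_
    simp
  -- The uniform parts `p / K` of the two indicators cancel, which leaves `-(1 - p)` if `k' ≠ k` and
  -- `0` otherwise.
  have hmean : ∑ j, (Measure.pi fun k : Fin K => columnLaw K p k)[X j] ≤ 0 := by
    refine Finset.sum_nonpos fun j _ => ?_
    by_cases hj : j ∈ S
    · have h1 : (Measure.pi fun k : Fin K => columnLaw K p k)[X j] = ∫ a, g a ∂columnLaw K p k := by
        rw [← (measurePreserving_eval (fun k => columnLaw K p k) k).map_eq]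
        rw [integral_map (measurable_pi_apply k).aemeasurable
          (measurable_of_finite g).aestronglyMeasurable]
        simp [X, hj]
      rw [h1, integral_fintype (Integrable.of_finite)]
      simp only [g, smul_eq_mul, mul_sub, mul_ite, mul_one, mul_zero, Finset.sum_sub_distrib,
        Finset.sum_ite_eq', Finset.mem_univ, if_true, columnLaw_real_singleton hp0 hp1]
      split_ifs <;> linarith
    · simp [X, hj]
  refine (measureReal_mono ?_).trans (pi_chebyshev hX hc hvar)
  intro Q hQ
  simp only [Set.mem_ofPred_eq] at hQ ⊢
  refine le_trans ?_ (le_abs_self _)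
  have : ∑ j, X j (Q j) = ∑ j ∈ S, g (Q j k) := by
    simp [X]
  rw [this]
  simp only [g]
  linarith

/-! ### Accuracy of models that have learned features -/

theorem Model.Learns.isMatched {f : Model K d dv ds} {T : Task K d dv ds} {V : Finset (Fin dv)}
    {S : Finset (Fin ds)} (h : f.Learns T V S) : f.IsMatched T := by
  intro k
  rw [h.classifier k]
  simp only [h.selector, ite_smul, one_smul, zero_smul, Finset.sum_ite_mem, Finset.univ_inter]

theorem Model.Learns.inl_sq {f : Model K d dv ds} {T : Task K d dv ds} {V : Finset (Fin dv)}
    {S : Finset (Fin ds)} (h : f.Learns T V S) (i : Fin dv) :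
    f.Φ (.inl i) ^ 2 = if i ∈ V then 1 else 0 := by
  rw [h.selector]; simp

theorem Model.Learns.inr_sq {f : Model K d dv ds} {T : Task K d dv ds} {V : Finset (Fin dv)}
    {S : Finset (Fin ds)} (h : f.Learns T V S) (j : Fin ds) :
    f.Φ (.inr j) ^ 2 = if j ∈ S then 1 else 0 := by
  rw [h.selector]; simp

theorem Model.Learns.sum_inl_sq {f : Model K d dv ds} {T : Task K d dv ds} {V : Finset (Fin dv)}
    {S : Finset (Fin ds)} (h : f.Learns T V S) : ∑ i, f.Φ (.inl i) ^ 2 = V.card := by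
  simp [h.inl_sq]

theorem Model.Learns.energy_eq {f : Model K d dv ds} {T : Task K d dv ds} {V : Finset (Fin dv)}
    {S : Finset (Fin ds)} (h : f.Learns T V S) : f.energy = V.card + S.card := by
  simp [Model.energy, h.inl_sq, h.inr_sq]

theorem Model.Learns.score_eq {f : Model K d dv ds} {T : Task K d dv ds} {V : Finset (Fin dv)}
    {S : Finset (Fin ds)} (h : f.Learns T V S) (y : Fin K) (Q : Fin ds → Fin K → Fin K)
    (k : Fin K) :
    f.score y Q k =
      V.card * (if y = k then 1 else 0) + ∑ j ∈ S, (if Q j y = k then (1 : ℝ) else 0) := by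
  simp only [Model.score, h.sum_inl_sq, h.inr_sq, ite_mul, one_mul, zero_mul,
    Finset.sum_ite_mem, Finset.univ_inter]

/-- Even if all spurious features agree on one wrong class, the label leads by `V.card - S.card ≥
1`. -/
theorem Model.Learns.le_accuracy_of_card_lt {f : Model K d dv ds} {T : Task K d dv ds}
    {V : Finset (Fin dv)} {S : Finset (Fin ds)} (h : f.Learns T V S) (hT : T.OrthogonalFeatures)
    (hK : K ≠ 0) (hp0 : 0 ≤ T.p) (hp1 : T.p ≤ 1) (hσ : 0 < T.sigma) (hcard : S.card < V.card) :
    1 - 4 * K * T.sigma ^ 2 * ((V.card : ℝ) + S.card) ^ 2 ≤ T.accuracy f := by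
  have h1 := T.le_accuracy hT hK hp0 hp1 hσ h.isMatched (δ := 0) (by
    intro y
    refine le_of_eq ?_
    convert measureReal_empty
    refine Set.eq_empty_of_forall_notMem ?_
    rintro Q ⟨k, hk, hlt⟩
    rw [h.score_eq, h.score_eq, if_pos rfl, if_neg hk.symm] at hlt
    have h2 : ∑ j ∈ S, (if Q j y = k then (1 : ℝ) else 0) ≤ S.card := by
      refine (Finset.sum_le_card_nsmul _ _ 1 fun j _ => ?_).trans (by simp)
      split_ifs <;> norm_num
    have h3 : 0 ≤ ∑ j ∈ S, (if Q j y = y then (1 : ℝ) else 0) :=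
      Finset.sum_nonneg fun j _ => by split_ifs <;> norm_num
    have h4 : (S.card : ℝ) + 1 ≤ V.card := by exact_mod_cast hcard
    linarith)
  rw [h.energy_eq] at h1
  linarith

/-- The spurious features may far outnumber the invariant ones: only `S.card / V.card ^ 2` has to be
small, since their excess fluctuates by about `√S.card`. -/
theorem Model.Learns.le_accuracy {f : Model K d dv ds} {T : Task K d dv ds}
    {V : Finset (Fin dv)} {S : Finset (Fin ds)} (h : f.Learns T V S) (hT : T.OrthogonalFeatures)
    (hK : K ≠ 0) (hp0 : 0 ≤ T.p) (hp1 : T.p ≤ 1) (hσ : 0 < T.sigma) (hcard : 2 ≤ V.card) :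
    1 - 4 * K * S.card / (V.card : ℝ) ^ 2 - 4 * K * T.sigma ^ 2 * ((V.card : ℝ) + S.card) ^ 2 ≤
      T.accuracy f := by
  have := isProbabilityMeasure_matrixLaw (ds := ds) hK hp0 hp1
  have hV : (2 : ℝ) ≤ V.card := by exact_mod_cast hcard
  have h1 := T.le_accuracy hT hK hp0 hp1 hσ h.isMatched
    (δ := 4 * K * S.card / (V.card : ℝ) ^ 2) (by
    intro y
    -- Failing the margin `1` takes an excess above `V.card - 1`, which is at least `V.card / 2`
    -- because `V.card ≥ 2`.
    refine (measureReal_mono (s₂ := ⋃ k : Fin K, {Q | (V.card : ℝ) / 2 ≤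
      ∑ j ∈ S, ((if Q j y = k then 1 else 0) - (if Q j y = y then 1 else 0) : ℝ)}) ?_).trans ?_
    · rintro Q ⟨k, hk, hlt⟩
      rw [h.score_eq, h.score_eq, if_pos rfl, if_neg hk.symm] at hlt
      refine Set.mem_iUnion.2 ⟨k, ?_⟩
      rw [Set.mem_ofPred_eq, Finset.sum_sub_distrib]
      linarith
    · refine (measureReal_iUnion_fintype_le _).trans ?_
      refine (Finset.sum_le_sum fun k _ =>
        matrixLaw_real_excess_le hK hp0 hp1 S (k := y) (k' := k) (by positivity)).trans
          (le_of_eq ?_)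
      simp only [Finset.sum_const, Finset.card_univ, Fintype.card_fin, nsmul_eq_mul]
      field_simp
      ring)
  rw [h.energy_eq] at h1
  exact h1

/-! ### Interpolation of models -/

/-- The interpolation `lam f + (1 - lam) f'`, in the selectors and in the classifiers. -/
noncomputable def Model.interpolate (lam : ℝ) (f f' : Model K d dv ds) : Model K d dv ds where
  Φ i := lam * f.Φ i + (1 - lam) * f'.Φ i
  w k := lam • f.w k + (1 - lam) • f'.w k

theorem Model.extrapolate_interpolate {lam : ℝ} (hlam : lam < 1) (f f' : Model K d dv ds) :
    Model.extrapolate lam f (Model.interpolate lam f f') = f' := by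
  have h : 1 - lam ≠ 0 := by linarith
  ext1
  · funext i
    simp only [Model.extrapolate, Model.interpolate]
    field_simp
    ring
  · funext k
    simp only [Model.extrapolate, Model.interpolate, add_sub_cancel_left, smul_smul,
      inv_mul_cancel₀ h, one_smul]

/-- This inverse makes the fine-tuned model an interpolation in every scenario; the other one
supplies the scenario that shows satisfiability. -/
theorem Model.interpolate_extrapolate {lam : ℝ} (hlam : lam < 1) (f f' : Model K d dv ds) :
    Model.interpolate lam f (Model.extrapolate lam f f') = f' := by
  have h : 1 - lam ≠ 0 := by linarith
  ext1
  · funext i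
    simp only [Model.extrapolate, Model.interpolate]
    field_simp
    ring
  · funext k
    simp only [Model.extrapolate, Model.interpolate, smul_smul, mul_inv_cancel₀ h, one_smul,
      add_sub_cancel]

/-- Being matched is linear in `(Φ, w)` jointly, so the fine-tuned model is covered although its
weights are not `0` or `1`. -/
theorem Model.IsMatched.interpolate {f f' : Model K d dv ds} {T : Task K d dv ds}
    (hf : f.IsMatched T) (hf' : f'.IsMatched T) (lam : ℝ) :
    (Model.interpolate lam f f').IsMatched T := by
  intro k
  simp only [Model.interpolate, hf k, hf' k, Finset.smul_sum, add_smul, Finset.sum_add_distrib,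
    smul_smul]

/-- Convexity of the square, with both coefficients at most `1`. -/
theorem Model.interpolate_sq_le {lam : ℝ} (hlam0 : 0 ≤ lam) (hlam1 : lam < 1)
    (f f' : Model K d dv ds) (i : Feature dv ds) :
    (Model.interpolate lam f f').Φ i ^ 2 ≤ f.Φ i ^ 2 + f'.Φ i ^ 2 := by
  have h : (Model.interpolate lam f f').Φ i ^ 2 =
      lam * f.Φ i ^ 2 + (1 - lam) * f'.Φ i ^ 2 - lam * (1 - lam) * (f.Φ i - f'.Φ i) ^ 2 := by
    simp only [Model.interpolate]; ring
  have h1 : 0 ≤ lam * (1 - lam) * (f.Φ i - f'.Φ i) ^ 2 :=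
    mul_nonneg (mul_nonneg hlam0 (by linarith)) (sq_nonneg _)
  nlinarith [sq_nonneg (f.Φ i), sq_nonneg (f'.Φ i)]

theorem Model.energy_interpolate_le {lam : ℝ} (hlam0 : 0 ≤ lam) (hlam1 : lam < 1)
    (f f' : Model K d dv ds) :
    (Model.interpolate lam f f').energy ≤ f.energy + f'.energy := by
  simp only [Model.energy, ← Finset.sum_add_distrib]
  exact Finset.sum_le_sum fun i _ => Model.interpolate_sq_le hlam0 hlam1 f f' i

theorem Model.energy_nonneg (f : Model K d dv ds) : 0 ≤ f.energy :=
  Finset.sum_nonneg fun _ _ => sq_nonneg _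

/-- If all spurious features of `f'` show class `k` in place of the label `y` and there are enough
of them, then the interpolation of `f` and `f'` scores higher on `k`. -/
theorem Model.score_interpolate_add_one_le {lam : ℝ} (hlam0 : 0 ≤ lam) (hlam1 : lam < 1)
    {f f' : Model K d dv ds} {T : Task K d dv ds} {V V' : Finset (Fin dv)} {S S' : Finset (Fin ds)}
    (hf : f.Learns T V S) (hf' : f'.Learns T V' S')
    (hcard : (V.card : ℝ) + V'.card + S.card + 1 ≤ (1 - lam) ^ 2 * S'.card)
    {y k : Fin K} (hyk : k ≠ y) {Q : Fin ds → Fin K → Fin K} (hQ : ∀ j ∈ S', Q j y = k) :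
    (Model.interpolate lam f f').score y Q y + 1 ≤ (Model.interpolate lam f f').score y Q k := by
  set g := Model.interpolate lam f f' with hg
  have h1 : ∑ i, g.Φ (.inl i) ^ 2 ≤ V.card + V'.card := by
    rw [← hf.sum_inl_sq, ← hf'.sum_inl_sq, ← Finset.sum_add_distrib]
    exact Finset.sum_le_sum fun i _ => Model.interpolate_sq_le hlam0 hlam1 f f' _
  -- The features in `S'` vote for `k`, so the label gets spurious votes only from outside `S'`,
  -- where `f'` has weight `0`.
  have h2 : ∑ j, g.Φ (.inr j) ^ 2 * (if Q j y = y then (1 : ℝ) else 0) ≤ S.card := by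
    have : (S.card : ℝ) = ∑ j, f.Φ (.inr j) ^ 2 := by simp [hf.inr_sq]
    rw [this]
    refine Finset.sum_le_sum fun j _ => ?_
    by_cases hj : j ∈ S'
    · rw [hQ j hj, if_neg hyk, mul_zero]
      exact sq_nonneg _
    · have h := Model.interpolate_sq_le hlam0 hlam1 f f' (.inr j)
      rw [hf'.inr_sq, if_neg hj, add_zero] at h
      refine le_trans ?_ h
      split_ifs
      · rw [mul_one]
      · rw [mul_zero]; exact sq_nonneg _
  have h3 : (1 - lam) ^ 2 * S'.card ≤ ∑ j, g.Φ (.inr j) ^ 2 * (if Q j y = k then (1 : ℝ) else 0) := by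
    have : (S'.card : ℝ) = ∑ j, f'.Φ (.inr j) ^ 2 := by simp [hf'.inr_sq]
    rw [this, Finset.mul_sum]
    refine Finset.sum_le_sum fun j _ => ?_
    by_cases hj : j ∈ S'
    · rw [hQ j hj, if_pos rfl, mul_one, hf'.inr_sq, if_pos hj, mul_one]
      simp only [hg, Model.interpolate, hf.selector, hf'.selector, Finset.inr_mem_disjSum, hj,
        if_true]
      split_ifs <;> nlinarith
    · rw [hf'.inr_sq, if_neg hj, mul_zero]
      exact mul_nonneg (sq_nonneg _) (by split_ifs <;> norm_num)
  simp only [Model.score, if_true, if_neg hyk.symm, mul_one, mul_zero, zero_add]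
  linarith

/-! ### Satisfiability of the assumptions -/

/-- A task with orthonormal class means. -/
noncomputable def orthonormalTask (K dv ds : ℕ) (p σ : ℝ) :
    Task K (Fintype.card (Feature dv ds × Fin K)) dv ds where
  mean i k := EuclideanSpace.single (Fintype.equivFin _ (i, k)) 1
  sigma := σ
  p := p

theorem orthonormalTask_orthogonalFeatures (K dv ds : ℕ) (p σ : ℝ) :
    (orthonormalTask K dv ds p σ).OrthogonalFeatures where
  norm_eq_one i k := by simp [orthonormalTask]
  orthogonal i k i' k' h := by
    simp only [orthonormalTask, EuclideanSpace.inner_single_left, PiLp.single_apply]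
    simp [h]

/-- The model that has learned the features in `V` and `S`. -/
noncomputable def Task.learner (T : Task K d dv ds) (V : Finset (Fin dv)) (S : Finset (Fin ds)) :
    Model K d dv ds where
  Φ i := if i ∈ V.disjSum S then 1 else 0
  w k := ∑ i ∈ V.disjSum S, T.mean i k

theorem Task.learner_learns (T : Task K d dv ds) (V : Finset (Fin dv)) (S : Finset (Fin ds)) :
    (T.learner V S).Learns T V S where
  selector _ := rfl
  classifier _ := rfl

theorem Model.numInvariant_le (f : Model K d dv ds) : f.numInvariant ≤ dv := by
  unfold Model.numInvariant
  refine (Finite.card_subtype_le _).trans (by simp)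

theorem Model.numSpurious_le (f : Model K d dv ds) : f.numSpurious ≤ ds := by
  unfold Model.numSpurious
  refine (Finite.card_subtype_le _).trans (by simp)

theorem exists_cdf_gaussian_pow_ge (K : ℕ) {εn : ℝ} (hεn : 0 < εn) :
    ∃ t : ℝ, 0 < t ∧ ∀ x, t ≤ x → 1 - εn ≤ cdf (gaussianReal 0 1) x ^ K := by
  have h := (tendsto_cdf_atTop (gaussianReal 0 1)).pow K
  rw [one_pow] at h
  obtain ⟨t, ht⟩ := Filter.eventually_atTop.1 (h.eventually (lt_mem_nhds (by linarith : 1 - εn < 1)))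
  exact ⟨max t 1, by positivity, fun x hx => (ht x ((le_max_left _ _).trans hx)).le⟩

/-- No accuracy exceeds `1`, so an optimal model need not be identified. -/
theorem Task.near_optimal_of_le {T : Task K d dv ds} (hK : K ≠ 0) (hp0 : 0 ≤ T.p) (hp1 : T.p ≤ 1)
    {f : Model K d dv ds} {ε : ℝ} (h : 1 - ε ≤ T.accuracy f) :
    |T.optimalAccuracy - T.accuracy f| ≤ ε := by
  have h1 := T.accuracy_le_one hK hp0 hp1
  have : Nonempty (Model K d dv ds) := ⟨f⟩
  have h2 : T.optimalAccuracy ≤ 1 := ciSup_le h1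
  have h3 : T.accuracy f ≤ T.optimalAccuracy :=
    le_ciSup (f := fun f => T.accuracy f) ⟨1, by rintro _ ⟨g, rfl⟩; exact h1 g⟩ f
  rw [abs_le]
  constructor <;> linarith

theorem exists_scenario {K : ℕ} (hK : K ≠ 0) {p : ℝ} (hp0 : 0 ≤ p) (hp1 : p ≤ 1) {lam : ℝ}
    (hlam1 : lam < 1) {ε εn σ : ℝ} (hσ : 0 < σ) (a b a' b' : ℕ) (ha' : 2 ≤ a')
    (hnoise : 1 - εn ≤ cdf (gaussianReal 0 1) (1 / (σ * ((a + a' : ℕ) + (b + b' : ℕ)))) ^ K)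
    (hacc : 4 * K * b' / (a' : ℝ) ^ 2 + 4 * K * σ ^ 2 * ((a' : ℝ) + b') ^ 2 ≤ ε) :
    ∃ (d dv ds : ℕ) (X : Scenario K d dv ds),
      X.HasParameters p σ ⟨a, b, a', b', 0, 0⟩ ∧ X.Assumptions lam ε εn := by
  obtain ⟨V, -, hV⟩ := Finset.exists_subset_card_eq (s := (Finset.univ : Finset (Fin (a + a'))))
    (n := a) (by simp)
  obtain ⟨S, -, hS⟩ := Finset.exists_subset_card_eq (s := (Finset.univ : Finset (Fin (b + b'))))
    (n := b) (by simp)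
  have hV' : Vᶜ.card = a' := by rw [Finset.card_compl, hV]; simp
  have hS' : Sᶜ.card = b' := by rw [Finset.card_compl, hS]; simp
  let T := orthonormalTask K (a + a') (b + b') p σ
  have hT : T.OrthogonalFeatures := orthonormalTask_orthogonalFeatures _ _ _ _ _
  -- Complementary feature sets give zero overlap, and the numbers of all features serve as `nvMax`
  -- and `nsMax`.
  refine ⟨_, _, _, ⟨T, T.learner V S, Model.interpolate lam (T.learner V S) (T.learner Vᶜ Sᶜ),
    T.learner Vᶜ Sᶜ, V, S, Vᶜ, Sᶜ, a + a', b + b'⟩, ?_, ?_⟩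
  · exact ⟨rfl, rfl, T.learner_learns _ _, T.learner_learns _ _, hV, hS, hV', hS',
      by simp [Finset.inter_comm], by simp [Finset.inter_comm], fun f _ => f.numInvariant_le, fun f _ => f.numSpurious_le⟩
  · refine ⟨⟨(Model.extrapolate_interpolate hlam1 _ _).symm, ?_⟩, hnoise, hT⟩
    refine Task.near_optimal_of_le hK hp0 hp1 ?_
    have h := (T.learner_learns Vᶜ Sᶜ).le_accuracy hT hK hp0 hp1 hσ (by omega)
    rw [hV', hS'] at h
    have hTσ : T.sigma = σ := rfl
    rw [hTσ] at h
    change 1 - ε ≤ T.accuracy _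
    linarith

/-! ### The accuracy gap and the choice of parameters -/

theorem accuracy_fTilde_lt {K : ℕ} (hK : 2 ≤ K) {p : ℝ} (hp0 : 0 ≤ p) (hp1 : p ≤ 1) {lam : ℝ}
    (hlam0 : 0 ≤ lam) (hlam1 : lam < 1) {ε εn σ : ℝ} (hσ : 0 < σ) {c : FeatureCounts}
    (hbar : c.nsBar < c.nvBar)
    (hcard : (c.nvBar : ℝ) + c.nvStar + c.nsBar + 1 ≤ (1 - lam) ^ 2 * c.nsStar)
    (hsmall : 4 * K * σ ^ 2 * ((c.nvBar : ℝ) + c.nsBar + (c.nvStar + c.nsStar)) ^ 2 ≤ 1 / 2)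
    (hsmall' : 4 * K * σ ^ 2 * ((c.nvBar : ℝ) + c.nsBar + (c.nvStar + c.nsStar)) ^ 2 <
      (p / K) ^ c.nsStar / (2 * K))
    {d dv ds : ℕ} {X : Scenario K d dv ds} (hX : X.HasParameters p σ c)
    (hA : X.Assumptions lam ε εn) :
    X.task.accuracy X.fTilde < X.task.accuracy X.fBar := by
  have hK0 : K ≠ 0 := by omega
  have hT := hA.orthogonal
  have hp : X.task.p = p := hX.p_eq
  have hs : X.task.sigma = σ := hX.sigma_eq
  have hp0' : 0 ≤ X.task.p := hp ▸ hp0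
  have hp1' : X.task.p ≤ 1 := hp ▸ hp1
  have hσ' : 0 < X.task.sigma := hs ▸ hσ
  have htilde : X.fTilde = Model.interpolate lam X.fBar X.fStar := by
    rw [hA.near_optimal.extrapolation, Model.interpolate_extrapolate hlam1]
  have h1 := hX.learns_bar.le_accuracy_of_card_lt hT hK0 hp0' hp1' hσ'
    (by rw [hX.card_VBar, hX.card_SBar]; exact hbar)
  rw [hX.card_VBar, hX.card_SBar, hs] at h1
  have hmono : 4 * K * σ ^ 2 * ((c.nvBar : ℝ) + c.nsBar) ^ 2 ≤
      4 * K * σ ^ 2 * ((c.nvBar : ℝ) + c.nsBar + (c.nvStar + c.nsStar)) ^ 2 := by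
    refine mul_le_mul_of_nonneg_left (pow_le_pow_left₀ (by positivity) ?_ 2) (by positivity)
    exact le_add_of_nonneg_right (by positivity)
  have henergy : X.fTilde.energy ≤ (c.nvBar : ℝ) + c.nsBar + (c.nvStar + c.nsStar) := by
    rw [htilde]
    refine (Model.energy_interpolate_le hlam0 hlam1 _ _).trans (le_of_eq ?_)
    rw [hX.learns_bar.energy_eq, hX.learns_star.energy_eq, hX.card_VBar, hX.card_SBar,
      hX.card_VStar, hX.card_SStar]
  have h0 := X.fTilde.energy_nonneg
  have h2 := X.task.accuracy_le hT hK0 hp0' hp1' hσ' (f := X.fTilde) (y := ⟨0, by omega⟩)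
    (k := ⟨1, by omega⟩) (A := {Q | ∀ j ∈ X.SStar, Q j ⟨0, by omega⟩ = ⟨1, by omega⟩})
    (by rw [htilde]; exact hX.learns_bar.isMatched.interpolate hX.learns_star.isMatched lam)
    (by
      refine le_trans ?_ hsmall
      rw [hs]
      gcongr)
    (by simp)
    (by
      intro Q hQ
      rw [htilde]
      refine Model.score_interpolate_add_one_le hlam0 hlam1 hX.learns_bar hX.learns_star ?_
        (by simp) hQ
      rw [hX.card_VBar, hX.card_SBar, hX.card_VStar, hX.card_SStar]
      exact hcard)
    (pow_le_matrixLaw_real hK0 hp0' hp1' _ _ _)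
  rw [hp, hX.card_SStar] at h2
  linarith

end FineTuning

theorem theorem2 (K : ℕ) (hK : 2 ≤ K) (p : ℝ) (hp0 : 0 < p) (hp1 : p ≤ 1)
    (lam : ℝ) (hlam0 : 0 ≤ lam) (hlam1 : lam < 1)
    (ε : ℝ) (hε : 0 < ε) (εn : ℝ) (hεn : 0 < εn) :
    ∃ (c : FineTuning.FeatureCounts) (σ₀ : ℝ),
      c.nvStar < c.nvBar ∧ 0 < c.nsBar ∧ c.nsBar < c.nsStar ∧ 0 < σ₀ ∧
      ∀ σ : ℝ, 0 < σ → σ ≤ σ₀ →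
        (∃ (d dv ds : ℕ) (X : FineTuning.Scenario K d dv ds),
          X.HasParameters p σ c ∧ X.Assumptions lam ε εn) ∧
        (∀ (d dv ds : ℕ) (X : FineTuning.Scenario K d dv ds),
          X.HasParameters p σ c → X.Assumptions lam ε εn →
          X.task.accuracy X.fTilde < X.task.accuracy X.fBar) := by
  have hK0 : K ≠ 0 := by omega
  have hKpos : (0 : ℝ) < K := by exact_mod_cast Nat.pos_of_ne_zero hK0
  have hlam : 0 < (1 - lam) ^ 2 := by have : 0 < 1 - lam := by linarith
                                      positivity
  -- The invariant and original spurious votes, plus the margin, come to `2 * m + 3 ≤ 5 * m`, hence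
  -- the `5`.
  obtain ⟨R, hR⟩ := exists_nat_ge (5 / (1 - lam) ^ 2)
  have hR5 : 5 ≤ (1 - lam) ^ 2 * R := by rwa [div_le_iff₀' hlam] at hR
  have hRpos : 1 ≤ R := by
    rcases Nat.eq_zero_or_pos R with h | h
    · rw [h] at hR5; norm_num at hR5
    · exact h
  obtain ⟨m₀, hm₀⟩ := exists_nat_ge (8 * K * R / ε)
  -- This makes the Chebyshev error `4 * K * R / m` of `f*` at most `ε / 2`; noise gets the other
  -- half.
  obtain ⟨m, hm, hmε⟩ : ∃ m : ℕ, 2 ≤ m ∧ 8 * K * R ≤ ε * m := by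
    rw [div_le_iff₀' hε] at hm₀
    refine ⟨m₀ + 2, by omega, hm₀.trans ?_⟩
    gcongr
    omega
  have hm2 : (2 : ℝ) ≤ m := by exact_mod_cast hm
  -- `M` bounds the energies of all three models and equals the feature count in the small noise
  -- condition.
  set M : ℝ := ((m + 1 : ℕ) : ℝ) + (1 : ℕ) + ((m : ℕ) + (R * m : ℕ)) with hM
  have hMpos : 0 < M := by positivity
  -- `η` bounds the noise error; the last halving makes the final inequality strict.
  set η : ℝ := min (min (1 / 2) (ε / 2)) ((p / K) ^ (R * m) / (2 * K) / 2) with hη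
  have hηpos : 0 < η := by positivity
  obtain ⟨t, ht, htε⟩ := FineTuning.exists_cdf_gaussian_pow_ge K hεn
  -- The three bounds on `σ` give small noise, `σ ^ 2 ≤ σ`, and noise error at most `η`.
  refine ⟨⟨m + 1, 1, m, R * m, 0, 0⟩, min (1 / (t * M)) (min 1 (η / (4 * K * M ^ 2))),
    by simp, by simp, ?_, by positivity, fun σ hσ hσ₀ => ?_⟩
  · calc 1 < m := by omega
      _ ≤ R * m := Nat.le_mul_of_pos_left _ hRpos
  have hσ1 : σ ≤ 1 / (t * M) := hσ₀.trans (min_le_left _ _)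
  have hσ2 : σ ≤ 1 := hσ₀.trans ((min_le_right _ _).trans (min_le_left _ _))
  have hσ3 : σ ≤ η / (4 * K * M ^ 2) := hσ₀.trans ((min_le_right _ _).trans (min_le_right _ _))
  have hsmall : 4 * K * σ ^ 2 * M ^ 2 ≤ η := by
    rw [le_div_iff₀ (by positivity)] at hσ3
    have h : σ ^ 2 ≤ σ := by nlinarith
    calc 4 * K * σ ^ 2 * M ^ 2 = σ ^ 2 * (4 * K * M ^ 2) := by ring
      _ ≤ σ * (4 * K * M ^ 2) := by gcongr
      _ ≤ η := hσ3
  have hη1 : η ≤ 1 / 2 := (min_le_left _ _).trans (min_le_left _ _)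
  have hη2 : η ≤ ε / 2 := (min_le_left _ _).trans (min_le_right _ _)
  have hη3 : η ≤ (p / K) ^ (R * m) / (2 * K) / 2 := min_le_right _ _
  have hqpos : 0 < (p / K) ^ (R * m) / (2 * K) := by positivity
  constructor
  · refine FineTuning.exists_scenario hK0 hp0.le hp1 hlam1 hσ _ _ _ _ hm (htε _ ?_) ?_
    · have hMM : (((m + 1 + m : ℕ) : ℝ) + (1 + R * m : ℕ)) = M := by
        rw [hM]; push_cast; ring
      rw [hMM, le_div_iff₀ (by positivity)]
      rw [le_div_iff₀ (by positivity)] at hσ1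
      linarith
    · have h1 : 4 * K * ((R * m : ℕ) : ℝ) / (m : ℝ) ^ 2 ≤ ε / 2 := by
        rw [div_le_iff₀ (by positivity)]
        push_cast
        nlinarith
      have h2 : 4 * K * σ ^ 2 * ((m : ℝ) + (R * m : ℕ)) ^ 2 ≤ 4 * K * σ ^ 2 * M ^ 2 := by
        refine mul_le_mul_of_nonneg_left (pow_le_pow_left₀ (by positivity) ?_ 2) (by positivity)
        exact le_add_of_nonneg_left (by positivity)
      linarith
  · intro d dv ds X hX hA
    have h3 : 4 * K * σ ^ 2 * M ^ 2 < (p / K) ^ (R * m) / (2 * K) := by linarith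
    refine FineTuning.accuracy_fTilde_lt hK hp0.le hp1 hlam0 hlam1 hσ ?_ ?_ ?_ ?_ hX hA
    · simp only; omega
    · simp only
      push_cast
      nlinarith
    · exact hsmall.trans hη1
    · exact h3
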